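/- Let $m$ be a positive integer. There is a constant $C_m>0$, depending only on $m$, such that for $\mathbb{K}=\mathbb{R}$ and for $\mathbb{K}=\mathbb{C}$, for every positive integer $n$ and every $p\in[1,\infty]$ there exists an $m$-linear form $A:\ell_p^n\times\cdots\times\ell_p^n\to\mathbb{K}$ of the form $$A\left(x^{(1)},\ldots,x^{(m)}\right)=\sum_{i_1,\ldots,i_m=1}^{n}\delta_{i_1\ldots i_m}\,x^{(1)}_{i_1}\cdots x^{(m)}_{i_m},\qquad \delta_{i_1\ldots i_m}\in\{-1,1\},$$ such that $$\|A\|\le C_m\, n^{\max\left\{m\left(\frac12-\frac1p\right)+\frac12,\ 1-\frac1p\right\}}.$$ Here $\ell_p^n$ is $\mathbb{K}^n$ with the $\ell_p$ norm, $\|A\|$ is the supremum of $|A(x^{(1)},\ldots,x^{(m)})|$ over all $x^{(1)},\ldots,x^{(m)}$ in the closed unit ball of $\ell_p^n$, and $\frac1p=0$ for $p=\infty$. -/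

import Mathlib

open scoped ENNReal

/-! A random sign form is good on complex Euclidean space, and that one case suffices. For fixed
unit vectors the random sum is subgaussian, so a union bound over a net of exponential size
(`exists_sign_forall_sum_le`, `exists_finset_net_unit_ball`) yields signs with norm at most `C √n`
on `ℓ₂`. The same signs serve every `p` and both fields. For `p ≥ 2`, the `ℓ_p` ball lies in the
`ℓ₂` ball of radius `n ^ (1/2 - 1/p)`, which costs that factor once per argument. For `p ≤ 2`,
interpolation between the trivial bound `1` on `ℓ₁` and `C √n` on `ℓ₂` gives `(C √n) ^ (2 (1 -
1/p))`. The real case follows by embedding real vectors in complex ones. -/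

/-! ### Random signs and the union bound -/

open Finset in
/-- Signs for which finitely many signed sums, each with square-summable coefficients, are
simultaneously small. -/
theorem exists_sign_forall_sum_le {α β : Type*} [Fintype α] (N : Finset β) (a : β → α → ℝ)
    (ha : ∀ b ∈ N, ∑ i, a b i ^ 2 ≤ 1) {L t : ℝ} (ht : 0 < t) (hN : (#N : ℝ) ≤ Real.exp L) :
    ∃ δ : α → ℝ, (∀ i, δ i = -1 ∨ δ i = 1) ∧ ∀ b ∈ N, ∑ i, δ i * a b i ≤ L / t + t / 2 := by
  classical
  set S : Finset (α → ℝ) := Fintype.piFinset fun _ => {-1, 1} with hS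
  have hmoment : ∀ b ∈ N, ∑ s ∈ S, Real.exp (t * ∑ i, s i * a b i) ≤
      2 ^ Fintype.card α * Real.exp (t ^ 2 / 2) := by
    intro b hb
    have h1 : ∑ s ∈ S, Real.exp (t * ∑ i, s i * a b i) =
        ∏ i, ∑ e ∈ ({-1, 1} : Finset ℝ), Real.exp (t * (e * a b i)) := by
      rw [prod_univ_sum]
      refine sum_congr rfl fun s _ => ?_
      rw [mul_sum, Real.exp_sum]
    have h2 : ∀ i, ∑ e ∈ ({-1, 1} : Finset ℝ), Real.exp (t * (e * a b i)) =
        2 * Real.cosh (t * a b i) := by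
      intro i
      rw [sum_pair (by norm_num), Real.cosh_eq]
      ring_nf
    calc _ = ∏ i, (2 * Real.cosh (t * a b i)) := by simp only [h1, h2]
      _ ≤ ∏ i, (2 * Real.exp ((t * a b i) ^ 2 / 2)) := by
        gcongr with i
        exact Real.cosh_le_exp_half_sq _
      _ = 2 ^ Fintype.card α * Real.exp (t ^ 2 / 2 * ∑ i, a b i ^ 2) := by
        rw [prod_mul_distrib, ← Real.exp_sum, mul_sum, prod_const, card_univ]
        congr 3 with i
        ring
      _ ≤ _ := by
        gcongr
        exact mul_le_of_le_one_right (by positivity) (ha b hb)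
  have hSne : S.Nonempty := Fintype.piFinset_nonempty.2 fun _ => ⟨1, by simp⟩
  have hScard : (#S : ℝ) = 2 ^ Fintype.card α := by
    rw [hS, Fintype.card_piFinset, prod_const, card_pair (by norm_num), card_univ]
    norm_num
  -- Some sign vector does no worse than the average; each term of its positive sum is then bounded
  -- by the whole.
  obtain ⟨δ, hδ, hle⟩ : ∃ s ∈ S, ∑ b ∈ N, Real.exp (t * ∑ i, s i * a b i) ≤
      Real.exp (L + t ^ 2 / 2) := by
    refine exists_le_of_sum_le hSne ?_
    rw [sum_comm, sum_const, nsmul_eq_mul, hScard]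
    calc _ ≤ ∑ b ∈ N, 2 ^ Fintype.card α * Real.exp (t ^ 2 / 2) := sum_le_sum hmoment
      _ = (#N : ℝ) * (2 ^ Fintype.card α * Real.exp (t ^ 2 / 2)) := by
        rw [sum_const, nsmul_eq_mul]
      _ ≤ Real.exp L * (2 ^ Fintype.card α * Real.exp (t ^ 2 / 2)) := by gcongr
      _ = _ := by rw [Real.exp_add]; ring
  refine ⟨δ, fun i => by simpa using Fintype.mem_piFinset.1 hδ i, fun b hb => ?_⟩
  have h := Real.exp_le_exp.1 ((single_le_sum (f := fun b => Real.exp (t * ∑ i, δ i * a b i))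
    (fun _ _ => (Real.exp_pos _).le) hb).trans hle)
  rw [← mul_le_mul_iff_right₀ ht]
  refine h.trans_eq ?_
  field_simp

/-! ### Nets in the unit ball -/

open Metric Module Function MeasureTheory Finset in
/-- The volume bound for the cardinality of a separated subset of the unit ball. -/
theorem card_le_of_separated_unit_ball {E : Type*} [NormedAddCommGroup E] [NormedSpace ℝ E]
    [FiniteDimensional ℝ E] {ε : ℝ} (hε : 0 < ε) (s : Finset E) (hs : ∀ c ∈ s, ‖c‖ ≤ 1)
    (h : ∀ c ∈ s, ∀ d ∈ s, c ≠ d → ε ≤ ‖c - d‖) : (#s : ℝ) ≤ (1 + 2 / ε) ^ finrank ℝ E := by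
  borelize E
  let μ : Measure E := Measure.addHaar
  have hε2 : 0 < ε / 2 := by positivity
  have hρ : 0 < 1 + ε / 2 := by positivity
  have hdisj : Set.Pairwise (s : Set E) (Disjoint on fun c => ball (c : E) (ε / 2)) := by
    rintro c hc d hd hcd
    apply ball_disjoint_ball
    rw [dist_eq_norm]
    linarith [h c hc d hd hcd]
  have hsub : (⋃ c ∈ s, ball (c : E) (ε / 2)) ⊆ ball (0 : E) (1 + ε / 2) := by
    refine Set.iUnion₂_subset fun x hx => ball_subset_ball' ?_
    rw [dist_zero_right]
    linarith [hs x hx]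
  have hvol : (#s : ℝ≥0∞) * ENNReal.ofReal ((ε / 2) ^ finrank ℝ E) * μ (ball 0 1) ≤
      ENNReal.ofReal ((1 + ε / 2) ^ finrank ℝ E) * μ (ball 0 1) :=
    calc _ = μ (⋃ c ∈ s, ball (c : E) (ε / 2)) := by
          rw [measure_biUnion_finset hdisj fun c _ => measurableSet_ball]
          simp only [μ.addHaar_ball_of_pos _ hε2, sum_const, nsmul_eq_mul, mul_assoc]
      _ ≤ μ (ball (0 : E) (1 + ε / 2)) := measure_mono hsub
      _ = _ := by simp only [μ.addHaar_ball_of_pos _ hρ]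
  have hJ := (ENNReal.mul_le_mul_iff_left (measure_ball_pos μ _ zero_lt_one).ne'
    measure_ball_lt_top.ne).1 hvol
  have hK : (#s : ℝ) * (ε / 2) ^ finrank ℝ E ≤ (1 + ε / 2) ^ finrank ℝ E := by
    have := ENNReal.toReal_le_of_le_ofReal (pow_nonneg hρ.le _) hJ
    rwa [ENNReal.toReal_mul, ENNReal.toReal_natCast,
      ENNReal.toReal_ofReal (by positivity)] at this
  rw [← le_div_iff₀ (by positivity), ← div_pow] at hK
  refine hK.trans_eq ?_
  congr 1
  field_simp
  ring

open Module Finset in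
/-- The unit ball of a finite-dimensional space has an `ε`-net of exponential cardinality. -/
theorem exists_finset_net_unit_ball (E : Type*) [NormedAddCommGroup E] [NormedSpace ℝ E]
    [FiniteDimensional ℝ E] {ε : ℝ} (hε : 0 < ε) :
    ∃ N : Finset E, (#N : ℝ) ≤ (1 + 2 / ε) ^ finrank ℝ E ∧ (∀ y ∈ N, ‖y‖ ≤ 1) ∧
      ∀ x : E, ‖x‖ ≤ 1 → ∃ y ∈ N, ‖x - y‖ ≤ ε := by
  classical
  let P : Finset E → Prop := fun s => (∀ c ∈ s, ‖c‖ ≤ 1) ∧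
    ∀ c ∈ s, ∀ d ∈ s, c ≠ d → ε ≤ ‖c - d‖
  let T : Set ℕ := {k | ∃ s, P s ∧ #s = k}
  have hT : BddAbove T := by
    refine ⟨⌊(1 + 2 / ε) ^ finrank ℝ E⌋₊, ?_⟩
    rintro _ ⟨s, hs, rfl⟩
    exact Nat.le_floor (card_le_of_separated_unit_ball hε s hs.1 hs.2)
  -- A separated set of maximal size is a net: a point far from it could be added.
  obtain ⟨N, hN, hcard⟩ : sSup T ∈ T := Nat.sSup_mem ⟨0, ∅, by simp [P], rfl⟩ hT
  refine ⟨N, card_le_of_separated_unit_ball hε N hN.1 hN.2, hN.1, fun x hx => ?_⟩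
  by_contra! hfar
  have hxN : x ∉ N := fun h => by simpa using hε.trans (hfar x h)
  have hmem : #(insert x N) ∈ T := by
    refine ⟨insert x N, ⟨?_, ?_⟩, rfl⟩
    · intro c hc
      rcases mem_insert.1 hc with rfl | hc
      exacts [hx, hN.1 c hc]
    · intro c hc d hd hcd
      rcases mem_insert.1 hc with rfl | hc' <;> rcases mem_insert.1 hd with rfl | hd'
      · exact absurd rfl hcd
      · exact (hfar d hd').le
      · rw [norm_sub_rev]; exact (hfar c hc').le
      · exact hN.2 c hc' d hd' hcd
  have := le_csSup hT hmem
  rw [card_insert_of_notMem hxN] at this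
  omega

/-! ### Sign forms and the Euclidean bound -/

/-- The multilinear form on `ℓ_p` spaces with prescribed coefficients. -/
noncomputable def coeffForm {𝕜 ι κ : Type*} [RCLike 𝕜] [Fintype ι] [Fintype κ] (p : ℝ≥0∞)
    [Fact (1 ≤ p)] (δ : (ι → κ) → 𝕜) :
    ContinuousMultilinearMap 𝕜 (fun _ : ι => PiLp p (fun _ : κ => 𝕜)) 𝕜 :=
  open Classical in
  ∑ i, δ i • (ContinuousMultilinearMap.mkPiAlgebra 𝕜 ι 𝕜).compContinuousLinearMap
    fun k => PiLp.proj p (fun _ => 𝕜) (i k)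

theorem coeffForm_apply {𝕜 ι κ : Type*} [RCLike 𝕜] [Fintype ι] [DecidableEq ι] [Fintype κ]
    (p : ℝ≥0∞) [Fact (1 ≤ p)] (δ : (ι → κ) → 𝕜) (x : ι → PiLp p (fun _ : κ => 𝕜)) :
    coeffForm p δ x = ∑ i, δ i * ∏ k, x k (i k) := by
  simp only [coeffForm, sum_apply, smul_apply,
    ContinuousMultilinearMap.compContinuousLinearMap_apply, ContinuousMultilinearMap.mkPiAlgebra_apply,
    PiLp.proj_apply, smul_eq_mul]
  congr!

theorem ContinuousMultilinearMap.opNorm_le_of_unit_ball {𝕜 ι G : Type*} {E : ι → Type*} [RCLike 𝕜]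
    [Fintype ι] [∀ i, NormedAddCommGroup (E i)] [∀ i, NormedSpace 𝕜 (E i)] [NormedAddCommGroup G]
    [NormedSpace 𝕜 G] (A : ContinuousMultilinearMap 𝕜 E G) {M : ℝ} (hM : 0 ≤ M)
    (h : ∀ x, (∀ i, ‖x i‖ ≤ 1) → ‖A x‖ ≤ M) : ‖A‖ ≤ M := by
  refine A.opNorm_le_bound hM fun x => ?_
  by_cases hx : ∃ i, x i = 0
  · obtain ⟨i, hi⟩ := hx
    rw [A.map_coord_zero i hi, norm_zero]
    positivity
  push Not at hx
  have hx' : ∀ i, ‖x i‖ ≠ 0 := fun i => norm_ne_zero_iff.2 (hx i)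
  have hscale : x = fun i => (‖x i‖ : 𝕜) • ((‖x i‖⁻¹ : 𝕜) • x i) := by
    funext i
    rw [smul_smul, mul_inv_cancel₀ (by simpa using hx' i), one_smul]
  have hunit := h (fun i => (‖x i‖⁻¹ : 𝕜) • x i) fun i => by
    rw [norm_smul, norm_inv, RCLike.norm_ofReal, abs_norm, inv_mul_cancel₀ (hx' i)]
  conv_lhs => rw [hscale]
  rw [A.map_smul_univ, norm_smul, norm_prod, mul_comm]
  simp only [RCLike.norm_ofReal, abs_norm]
  gcongr

open Finset in
/-- For every multilinear degree there are sign forms on complex Euclidean space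
with norm at most a constant times the square root of the dimension. -/
theorem exists_sign_norm_coeffForm_two_le (m : ℕ) (hm : 0 < m) :
    ∃ C : ℝ, 1 ≤ C ∧ ∀ n : ℕ, 0 < n → ∃ δ : (Fin m → Fin n) → ℝ,
      (∀ i, δ i = -1 ∨ δ i = 1) ∧
      ‖coeffForm 2 fun i => (δ i : ℂ)‖ ≤ C * Real.sqrt n := by
  have hm' : (0 : ℝ) < m := by exact_mod_cast hm
  set c := Real.log (1 + 2 / (1 / (2 * m : ℝ))) with hc
  have hc0 : 0 ≤ c := Real.log_nonneg (by have : 0 ≤ 2 / (1 / (2 * m : ℝ)) := by positivity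
                                          linarith)
  refine ⟨4 * m * c + 1, by have := mul_nonneg hm'.le hc0; linarith, fun n hn => ?_⟩
  have hn' : (0 : ℝ) < n := by exact_mod_cast hn
  -- With mesh `1 / (2 * m)`, moving all `m` arguments to the net costs at most `‖A‖ / 2`, which is
  -- absorbed at the end.
  obtain ⟨N, hNcard, hN1, hNnet⟩ := exists_finset_net_unit_ball (EuclideanSpace ℂ (Fin n))
    (ε := 1 / (2 * m)) (by positivity)
  have hrank : Module.finrank ℝ (EuclideanSpace ℂ (Fin n)) = 2 * n := by
    rw [finrank_real_of_complex, finrank_euclideanSpace_fin]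
  rw [hrank] at hNcard
  set NN : Finset (Fin m → EuclideanSpace ℂ (Fin n)) := Fintype.piFinset fun _ => N with hNN
  -- Since `L` is of order `n`, taking `t = √n` makes both `L / t` and `t / 2` of order `√n`.
  obtain ⟨δ, hδ, hle⟩ := exists_sign_forall_sum_le NN
    (fun y (i : Fin m → Fin n) => (∏ k, y k (i k)).re) (L := 2 * n * m * c) (t := Real.sqrt n)
    (by
      intro y hy
      calc ∑ i : Fin m → Fin n, (∏ k, y k (i k)).re ^ 2
          ≤ ∑ i : Fin m → Fin n, ∏ k, ‖y k (i k)‖ ^ 2 := by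
            gcongr with i
            rw [prod_pow, ← norm_prod, ← sq_abs]
            gcongr
            exact Complex.abs_re_le_norm _
        _ = ∏ k, ∑ j, ‖y k j‖ ^ 2 := by
            rw [prod_univ_sum, Fintype.piFinset_univ]
        _ ≤ 1 := by
            refine prod_le_one (fun k _ => by positivity) fun k _ => ?_
            rw [← EuclideanSpace.norm_sq_eq]
            exact pow_le_one₀ (norm_nonneg _) (hN1 _ (Fintype.mem_piFinset.1 hy k)))
    (by positivity)
    (by
      rw [hNN, Fintype.card_piFinset, prod_const, card_univ, Fintype.card_fin]
      push_cast
      calc (#N : ℝ) ^ m ≤ ((1 + 2 / (1 / (2 * m : ℝ))) ^ (2 * n)) ^ m := by gcongr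
        _ = Real.exp (c * ((2 * n * m : ℕ) : ℝ)) := by
          rw [mul_comm c, Real.exp_nat_mul, hc, Real.exp_log (by positivity), ← pow_mul]
        _ ≤ _ := by
          apply le_of_eq
          push_cast
          ring_nf)
  refine ⟨δ, hδ, ?_⟩
  set A := coeffForm 2 fun i => (δ i : ℂ) with hA
  set M : ℝ := (2 * m * c + 1 / 2) * Real.sqrt n with hM
  have hM0 : 0 ≤ M := by positivity
  have hnet : ∀ y ∈ NN, (A y).re ≤ M := by
    intro y hy
    rw [hA, coeffForm_apply, Complex.re_sum]
    simp only [Complex.re_ofReal_mul]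
    refine (hle y hy).trans_eq ?_
    rw [hM]
    have := Real.mul_self_sqrt hn'.le
    have hs : Real.sqrt n ≠ 0 := by positivity
    field_simp
    rw [Real.sq_sqrt hn'.le]
    ring
  have hre : ∀ x : Fin m → EuclideanSpace ℂ (Fin n), (∀ k, ‖x k‖ ≤ 1) →
      (A x).re ≤ M + ‖A‖ / 2 := by
    intro x hx
    choose y hyN hy using fun k => hNnet (x k) (hx k)
    have hdiff := A.norm_image_sub_le x y
    have hmax : max ‖x‖ ‖y‖ ≤ 1 := max_le ((pi_norm_le_iff_of_nonneg zero_le_one).2 hx)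
      ((pi_norm_le_iff_of_nonneg zero_le_one).2 fun k => hN1 _ (hyN k))
    have hxy : ‖x - y‖ ≤ 1 / (2 * m) := (pi_norm_le_iff_of_nonneg (by positivity)).2 hy
    have hdiff' : ‖A x - A y‖ ≤ ‖A‖ / 2 := by
      calc _ ≤ ‖A‖ * m * 1 ^ (m - 1) * (1 / (2 * m)) := by
            refine hdiff.trans ?_
            rw [Fintype.card_fin]
            gcongr
        _ = _ := by rw [one_pow]; field_simp
    have h1 := (Complex.re_le_norm (A x - A y)).trans hdiff'
    rw [Complex.sub_re] at h1
    linarith [hnet y (Fintype.mem_piFinset.2 hyN)]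
  have hnorm : ‖A‖ ≤ M + ‖A‖ / 2 := by
    refine A.opNorm_le_of_unit_ball (by positivity) fun x hx => ?_
    -- Rotating one argument by a phase makes the value real and nonnegative, so bounding real parts
    -- is enough.
    obtain ⟨u, hu, hux⟩ : ∃ u : ℂ, ‖u‖ = 1 ∧ u * A x = ‖A x‖ := by
      by_cases h0 : A x = 0
      · exact ⟨1, by simp, by simp [h0]⟩
      · have h0' : (‖A x‖ : ℂ) ≠ 0 := by simpa using h0
        refine ⟨‖A x‖ / A x, ?_, by field_simp⟩
        rw [norm_div, Complex.norm_real, norm_norm, div_self (by simpa using h0)]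
    let k₀ : Fin m := ⟨0, hm⟩
    have h1 : A (Function.update x k₀ (u • x k₀)) = ‖A x‖ := by
      rw [A.map_update_smul, Function.update_eq_self, smul_eq_mul, hux]
    have h2 := hre (Function.update x k₀ (u • x k₀)) fun k => by
      by_cases hk : k = k₀
      · subst hk
        simpa [norm_smul, hu] using hx k₀
      · simpa [hk] using hx k
    rwa [h1, Complex.ofReal_re] at h2
  have : ‖A‖ ≤ 2 * M := by linarith
  refine this.trans_eq ?_
  rw [hM]
  ring

/-! ### Interpolation between `ℓ₁` and `ℓ₂` -/

/-- The holomorphic family `z ↦ w |w| ^ (r (1 - z / 2) - 1)` through the scalar `w`. -/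
noncomputable def stripFamily (r : ℝ) (w z : ℂ) : ℂ :=
  w * Complex.exp (Real.log ‖w‖ * (r * (1 - z / 2) - 1))

theorem differentiable_stripFamily (r : ℝ) (w : ℂ) : Differentiable ℂ (stripFamily r w) := by
  unfold stripFamily
  fun_prop

/-- Equality can fail only at `w = 0`, where the right side is `0 ^ 0 = 1` if `Re z = 2`. -/
theorem norm_stripFamily_le (r : ℝ) (w z : ℂ) :
    ‖stripFamily r w z‖ ≤ ‖w‖ ^ (r * (1 - z.re / 2)) := by
  by_cases hw : w = 0
  · simp only [stripFamily, hw, zero_mul, norm_zero]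
    positivity
  have hw' : 0 < ‖w‖ := norm_pos_iff.2 hw
  apply le_of_eq
  have hre : ((Real.log ‖w‖ : ℂ) * (r * (1 - z / 2) - 1)).re =
      Real.log ‖w‖ * (r * (1 - z.re / 2) - 1) := by
    rw [Complex.re_ofReal_mul, Complex.sub_re, Complex.re_ofReal_mul, Complex.sub_re,
      Complex.one_re, Complex.div_ofNat_re]
  rw [stripFamily, norm_mul, Complex.norm_exp, hre, ← Real.rpow_def_of_pos hw',
    Real.rpow_sub_one hw'.ne', mul_div_cancel₀ _ hw'.ne']

open Finset in
/-- A form with coefficients of modulus at most one that is bounded on the `ℓ₂` ball satisfies the interpolated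
bound on the `ℓ_r` ball, `1 ≤ r ≤ 2`. -/
theorem norm_sum_le_rpow_of_le_two {ι κ : Type*} [Fintype ι] [DecidableEq ι] [Fintype κ]
    (δ : (ι → κ) → ℂ) (hδ : ∀ i, ‖δ i‖ ≤ 1) {B : ℝ}
    (hB : ∀ x : ι → κ → ℂ, (∀ k, ∑ j, ‖x k j‖ ^ 2 ≤ 1) → ‖∑ i, δ i * ∏ k, x k (i k)‖ ≤ B)
    {r : ℝ} (hr1 : 1 ≤ r) (hr2 : r ≤ 2) (x : ι → κ → ℂ) (hx : ∀ k, ∑ j, ‖x k j‖ ^ r ≤ 1) :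
    ‖∑ i, δ i * ∏ k, x k (i k)‖ ≤ B ^ (2 * (1 - 1 / r)) := by
  have hr0 : 0 < r := by linarith
  have hx1 : ∀ k j, ‖x k j‖ ≤ 1 := by
    intro k j
    have := (single_le_sum (f := fun j => ‖x k j‖ ^ r) (fun _ _ => by positivity)
      (mem_univ j)).trans (hx k)
    by_contra! hlt
    exact absurd (Real.one_lt_rpow hlt hr0) this.not_gt
  have htriangle : ∀ y : ι → κ → ℂ, ‖∑ i, δ i * ∏ k, y k (i k)‖ ≤ ∑ i : ι → κ, ∏ k, ‖y k (i k)‖ := by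
    intro y
    refine (norm_sum_le _ _).trans (sum_le_sum fun i _ => ?_)
    rw [norm_mul, norm_prod]
    exact mul_le_of_le_one_left (by positivity) (hδ i)
  let f : ℂ → ℂ := fun z => ∑ i, δ i * ∏ k, stripFamily r (x k (i k)) z
  have hf : Differentiable ℂ f := by
    have := differentiable_stripFamily r
    fun_prop
  have hθ : (2 * (1 - 1 / r) : ℝ) ∈ Set.Icc (0 : ℝ) 1 := by
    have h1 : 1 / r ≤ 1 := by rw [div_le_one hr0]; exact hr1
    have h2 : 1 / 2 ≤ 1 / r := one_div_le_one_div_of_le hr0 hr2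
    constructor <;> linarith
  -- At this point `r (1 - z / 2) = 1`, so the family returns `x` itself. On `Re z = 0` and `Re z =
  -- 1` the moduli are `|x| ^ r` and `|x| ^ (r / 2)`, giving unit balls of `ℓ₁` and `ℓ₂`.
  have hfθ : f ((2 * (1 - 1 / r) : ℝ) : ℂ) = ∑ i, δ i * ∏ k, x k (i k) := by
    have hexp : (r : ℂ) * (1 - ((2 * (1 - 1 / r) : ℝ) : ℂ) / 2) - 1 = 0 := by
      have : (r : ℂ) ≠ 0 := by exact_mod_cast hr0.ne'
      push_cast
      field_simp
      ring
    simp only [f, stripFamily, hexp, mul_zero, Complex.exp_zero, mul_one]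
  have hbdd : BddAbove ((norm ∘ f) '' Complex.HadamardThreeLines.verticalClosedStrip 0 1) := by
    refine ⟨∑ i : ι → κ, ∏ k : ι, 1, ?_⟩
    rintro _ ⟨z, hz, rfl⟩
    refine (htriangle fun k j => stripFamily r (x k j) z).trans ?_
    gcongr with i _ k
    refine (norm_stripFamily_le r _ z).trans (Real.rpow_le_one (norm_nonneg _) (hx1 _ _) ?_)
    have : z.re ≤ 1 := hz.2
    exact mul_nonneg hr0.le (by linarith)
  have h0 : ∀ z ∈ Complex.re ⁻¹' {0}, ‖f z‖ ≤ 1 := by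
    intro z hz
    have hz : z.re = 0 := hz
    calc ‖f z‖ ≤ ∑ i : ι → κ, ∏ k, ‖stripFamily r (x k (i k)) z‖ :=
        htriangle fun k j => stripFamily r (x k j) z
      _ = ∏ k, ∑ j, ‖stripFamily r (x k j) z‖ := by
        rw [prod_univ_sum, Fintype.piFinset_univ]
      _ ≤ 1 := by
        refine prod_le_one (fun k _ => sum_nonneg fun j _ => norm_nonneg _) fun k _ => ?_
        refine (sum_le_sum fun j _ => ?_).trans (hx k)
        refine (norm_stripFamily_le r _ z).trans_eq ?_
        rw [hz]
        ring_nf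
  have h1 : ∀ z ∈ Complex.re ⁻¹' {1}, ‖f z‖ ≤ B := by
    intro z hz
    have hz : z.re = 1 := hz
    refine hB (fun k j => stripFamily r (x k j) z) fun k => ?_
    refine (sum_le_sum fun j _ => ?_).trans (hx k)
    refine (pow_le_pow_left₀ (norm_nonneg _) (norm_stripFamily_le r _ z) 2).trans_eq ?_
    rw [hz, ← Real.rpow_mul_natCast (norm_nonneg _)]
    congr 1
    push_cast
    ring
  have h := Complex.HadamardThreeLines.norm_le_interp_of_mem_verticalClosedStrip' zero_lt_one
    (z := ((2 * (1 - 1 / r) : ℝ) : ℂ)) hθ hf.diffContOnCl hbdd h0 h1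
  rw [hfθ, Complex.ofReal_re] at h
  simpa using h

open Finset in
/-- Comparison of the `ℓ₂` and `ℓ_r` norms in dimension `n`, for `2 ≤ r`. -/
theorem sum_sq_le_of_sum_rpow_le_one {κ : Type*} [Fintype κ] [Nonempty κ] {r : ℝ} (hr : 2 ≤ r)
    (y : κ → ℝ) (hy0 : ∀ j, 0 ≤ y j) (hy : ∑ j, y j ^ r ≤ 1) :
    ∑ j, y j ^ 2 ≤ ((Fintype.card κ : ℝ) ^ (1 / 2 - 1 / r)) ^ 2 := by
  have hr0 : 0 < r := by linarith
  have hs0 : 0 ≤ ∑ j, y j ^ 2 := by positivity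
  have hcard : (0 : ℝ) < Fintype.card κ := by exact_mod_cast Fintype.card_pos
  -- Power mean inequality with exponent `r / 2 ≥ 1`, applied to the squares.
  have h := Real.rpow_sum_le_const_mul_sum_rpow univ (fun j => y j ^ 2) (p := r / 2) (by linarith)
  have hpow : ∀ j, |y j ^ 2| ^ (r / 2) = y j ^ r := by
    intro j
    rw [abs_of_nonneg (by positivity), ← Real.rpow_natCast, ← Real.rpow_mul (hy0 j)]
    congr 1
    push_cast
    ring
  simp only [hpow, card_univ] at h
  simp only [abs_pow, sq_abs] at h
  have h' : (∑ j, y j ^ 2) ^ (r / 2) ≤ (Fintype.card κ : ℝ) ^ (r / 2 - 1) :=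
    h.trans (mul_le_of_le_one_right (by positivity) hy)
  have h2 := Real.rpow_le_rpow (by positivity) h' (z := 2 / r) (by positivity)
  rw [← Real.rpow_mul hs0, ← Real.rpow_mul hcard.le] at h2
  have e1 : r / 2 * (2 / r) = 1 := by field_simp
  have e2 : (r / 2 - 1) * (2 / r) = (1 / 2 - 1 / r) * (2 : ℕ) := by
    push_cast
    field_simp
  rwa [e1, Real.rpow_one, e2, Real.rpow_mul_natCast hcard.le] at h2

/-! ### Transfer to both fields and to all `p` -/

/-- The canonical ring homomorphism from a real or complex field to `ℂ`. -/
noncomputable def RCLike.toComplexHom (𝕜 : Type*) [RCLike 𝕜] : 𝕜 →+* ℂ where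
  toFun x := ⟨RCLike.re x, RCLike.im x⟩
  map_one' := Complex.ext (by simp) (by simp)
  map_mul' x y := Complex.ext (by simp) (by simp)
  map_zero' := Complex.ext (by simp) (by simp)
  map_add' x y := Complex.ext (by simp) (by simp)

theorem RCLike.norm_toComplexHom {𝕜 : Type*} [RCLike 𝕜] (x : 𝕜) :
    ‖RCLike.toComplexHom 𝕜 x‖ = ‖x‖ := by
  have h : ‖RCLike.toComplexHom 𝕜 x‖ ^ 2 = ‖x‖ ^ 2 := by
    rw [← Complex.normSq_eq_norm_sq, RCLike.norm_sq_eq_def]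
    simp [RCLike.toComplexHom, Complex.normSq_apply]
  exact (pow_left_inj₀ (norm_nonneg _) (norm_nonneg _) two_ne_zero).1 h

theorem RCLike.toComplexHom_ofReal {𝕜 : Type*} [RCLike 𝕜] (t : ℝ) :
    RCLike.toComplexHom 𝕜 (t : 𝕜) = t :=
  Complex.ext (by simp [RCLike.toComplexHom]) (by simp [RCLike.toComplexHom])

/-- Sums with real coefficients have the same norm over any real or complex field and over `ℂ`. -/
theorem norm_coeffForm_ofReal {𝕜 ι κ : Type*} [RCLike 𝕜] [Fintype ι] [DecidableEq ι] [Fintype κ]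
    (p : ℝ≥0∞) [Fact (1 ≤ p)] (δ : (ι → κ) → ℝ) (x : ι → PiLp p (fun _ : κ => 𝕜)) :
    ‖coeffForm p (fun i => (δ i : 𝕜)) x‖ =
      ‖∑ i : ι → κ, (δ i : ℂ) * ∏ k, RCLike.toComplexHom 𝕜 (x k (i k))‖ := by
  rw [← RCLike.norm_toComplexHom, coeffForm_apply]
  simp only [map_sum, map_mul, map_prod, RCLike.toComplexHom_ofReal]

/-- A bound on the norm of a form on complex Euclidean space bounds it on Euclidean balls. -/
theorem norm_sum_le_of_norm_coeffForm_two_le {ι κ : Type*} [Fintype ι] [DecidableEq ι] [Fintype κ]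
    {δ : (ι → κ) → ℂ} {B D : ℝ} (hB : ‖coeffForm 2 δ‖ ≤ B) (hD : 0 ≤ D) (y : ι → κ → ℂ)
    (hy : ∀ k, ∑ j, ‖y k j‖ ^ 2 ≤ D ^ 2) :
    ‖∑ i, δ i * ∏ k, y k (i k)‖ ≤ B * D ^ Fintype.card ι := by
  have hB0 : 0 ≤ B := (norm_nonneg _).trans hB
  have h := (coeffForm 2 δ).le_opNorm fun k => WithLp.toLp 2 (y k)
  rw [coeffForm_apply] at h
  refine h.trans ?_
  rw [← Finset.card_univ, ← Finset.prod_const]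
  gcongr with k
  refine (pow_le_pow_iff_left₀ (norm_nonneg _) hD two_ne_zero).1 ?_
  rw [EuclideanSpace.norm_sq_eq]
  exact hy k

theorem PiLp.sum_norm_rpow_le_one {κ 𝕜 : Type*} [Fintype κ] [RCLike 𝕜] {p : ℝ≥0∞}
    (hp : 0 < p.toReal) (x : PiLp p (fun _ : κ => 𝕜)) (hx : ‖x‖ ≤ 1) :
    ∑ j, ‖x j‖ ^ p.toReal ≤ 1 := by
  rw [PiLp.norm_eq_sum hp] at hx
  by_contra! h
  exact absurd (Real.one_lt_rpow h (one_div_pos.2 hp)) hx.not_gt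

/-- Comparison of the `ℓ₂` and `ℓ_p` norms in dimension `n`, for `2 ≤ p ≤ ∞`. -/
theorem PiLp.sum_norm_sq_le_of_two_le {κ 𝕜 : Type*} [Fintype κ] [Nonempty κ] [RCLike 𝕜] {p : ℝ≥0∞}
    [Fact (1 ≤ p)] (hp : 2 ≤ p) (x : PiLp p (fun _ : κ => 𝕜)) (hx : ‖x‖ ≤ 1) :
    ∑ j, ‖x j‖ ^ 2 ≤ ((Fintype.card κ : ℝ) ^ (1 / 2 - (1 / p).toReal)) ^ 2 := by
  by_cases htop : p = ⊤
  · have hcard : (0 : ℝ) ≤ Fintype.card κ := by positivity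
    subst htop
    rw [← Real.rpow_mul_natCast hcard]
    calc ∑ j, ‖x j‖ ^ 2 ≤ ∑ _j : κ, (1 : ℝ) := by
          gcongr with j
          exact pow_le_one₀ (norm_nonneg _) ((PiLp.norm_apply_le x j).trans hx)
      _ = _ := by simp
  · have hp2 : 2 ≤ p.toReal := by
      simpa using ENNReal.toReal_mono htop hp
    rw [one_div p, ENNReal.toReal_inv, ← one_div]
    exact sum_sq_le_of_sum_rpow_le_one hp2 _ (fun _ => norm_nonneg _)
      (PiLp.sum_norm_rpow_le_one (by linarith) x hx)

theorem theorem2p2 (m : ℕ) (hm : 0 < m) :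
    ∃ C : ℝ, 0 < C ∧
      ∀ (𝕜 : Type*) [RCLike 𝕜] (n : ℕ), 0 < n → ∀ (p : ℝ≥0∞) [Fact (1 ≤ p)],
        ∃ (A : ContinuousMultilinearMap 𝕜
              (fun _ : Fin m => PiLp p (fun _ : Fin n => 𝕜)) 𝕜)
          (δ : (Fin m → Fin n) → 𝕜),
          (∀ i, δ i = -1 ∨ δ i = 1) ∧
          (∀ x : Fin m → PiLp p (fun _ : Fin n => 𝕜),
            A x = ∑ i : Fin m → Fin n, δ i * ∏ k : Fin m, x k (i k)) ∧
          ‖A‖ ≤ C * (n : ℝ) ^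
            max ((m : ℝ) * (1 / 2 - (1 / p).toReal) + 1 / 2) (1 - (1 / p).toReal) := by
  obtain ⟨C, hC, h⟩ := exists_sign_norm_coeffForm_two_le m hm
  have hC0 : 0 < C := by linarith
  refine ⟨C, hC0, fun 𝕜 _ n hn p hp => ?_⟩
  obtain ⟨δ, hδ, hnorm⟩ := h n hn
  refine ⟨coeffForm p fun i => (δ i : 𝕜), fun i => (δ i : 𝕜), fun i => ?_,
    coeffForm_apply p _, ?_⟩
  · rcases hδ i with h | h <;> simp [h]
  have hn0 : (0 : ℝ) < n := by exact_mod_cast hn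
  have hn1 : (1 : ℝ) ≤ n := by exact_mod_cast hn
  have : Nonempty (Fin n) := ⟨⟨0, hn⟩⟩
  refine ContinuousMultilinearMap.opNorm_le_of_unit_ball _ (by positivity) fun x hx => ?_
  rw [norm_coeffForm_ofReal]
  set y : Fin m → Fin n → ℂ := fun k j => RCLike.toComplexHom 𝕜 (x k j) with hy
  have hynorm : ∀ k j, ‖y k j‖ = ‖x k j‖ := fun k j => RCLike.norm_toComplexHom _
  rcases le_total 2 p with hp2 | hp2
  · have hbound := norm_sum_le_of_norm_coeffForm_two_le hnorm
      (D := (n : ℝ) ^ (1 / 2 - (1 / p).toReal)) (by positivity) y fun k => by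
        simpa only [hynorm, Fintype.card_fin] using PiLp.sum_norm_sq_le_of_two_le hp2 (x k) (hx k)
    calc _ ≤ _ := hbound
      _ = C * (n : ℝ) ^ ((m : ℝ) * (1 / 2 - (1 / p).toReal) + 1 / 2) := by
        rw [Fintype.card_fin, ← Real.rpow_mul_natCast hn0.le, Real.sqrt_eq_rpow, mul_assoc,
          ← Real.rpow_add hn0]
        ring_nf
      _ ≤ _ := by
        gcongr
        exact le_max_left _ _
  · have htop : p ≠ ⊤ := ne_top_of_le_ne_top ENNReal.ofNat_ne_top hp2
    have hr1 : 1 ≤ p.toReal := by simpa using ENNReal.toReal_mono htop hp.out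
    have hr2 : p.toReal ≤ 2 := by simpa using ENNReal.toReal_mono ENNReal.ofNat_ne_top hp2
    have hinv : (1 / p).toReal = 1 / p.toReal := by
      rw [one_div, ENNReal.toReal_inv, one_div]
    have hbound := norm_sum_le_rpow_of_le_two (fun i => (δ i : ℂ))
      (fun i => by rcases hδ i with h | h <;> simp [h])
      (fun z hz => by
        simpa using norm_sum_le_of_norm_coeffForm_two_le hnorm zero_le_one z (by simpa using hz))
      hr1 hr2 y (fun k => by
        simpa only [hynorm] using PiLp.sum_norm_rpow_le_one (by linarith) (x k) (hx k))
    have hr1' : 1 / p.toReal ≤ 1 := by rw [div_le_one (by linarith)]; exact hr1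
    have hr2' : 1 / 2 ≤ 1 / p.toReal := one_div_le_one_div_of_le (by linarith) hr2
    calc _ ≤ _ := hbound
      _ = C ^ (2 * (1 - 1 / p.toReal)) * (n : ℝ) ^ (1 - 1 / p.toReal) := by
        rw [Real.mul_rpow hC0.le (Real.sqrt_nonneg _), Real.sqrt_eq_rpow, ← Real.rpow_mul hn0.le]
        congr 2
        ring
      -- `C ≥ 1` and the exponent is at most `1`, so the constant does not depend on `p`.
      _ ≤ C ^ (1 : ℝ) * (n : ℝ) ^ (1 - 1 / p.toReal) := by
        gcongr
        linarith
      _ ≤ _ := by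
        rw [Real.rpow_one, hinv]
        gcongr
        exact le_max_right _ _
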